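/- Let $\Omega\subset\mathbb R^N$ be a bounded open set, $A,b_0>0$, $\sigma\in(0,2)$, $m>\max\{1,\sigma\}$ and $\theta\in[0,m)$. Let $\{\nu_x\}_{x\in\mathbb R^N}$ be a family of Borel measures on $\mathbb R^N$ satisfying, with $B_\delta=\{|z|<\delta\}$: (M1) for all $R>0$ and $\alpha\in[0,2]$ there is a constant $C^{(1)}_{R,\alpha}>0$ such that for all $\delta>0$ $$\sup_{|x|\le R}\int_{B_\delta^c}\min\{1,|z|^\alpha\}\,\nu_x(dz)\le C^{(1)}_{R,\alpha}\,h_{\alpha,\sigma}(\delta),$$ where $h_{\alpha,\sigma}(\delta)=\delta^{\alpha-\sigma}$ if $\alpha<\sigma$, $|\ln\delta|+1$ if $\alpha=\sigma$, and $1$ if $\alpha>\sigma$ (and $|z|^0=1$); (M2) for all $R>0$ and $\alpha\in(\sigma,2]$ there is a constant $C^{(2)}_{R,\alpha}>0$ such that for all $\delta\in(0,1)$ $$\sup_{|x|\le R}\int_{B_\delta}|z|^\alpha\,\nu_x(dz)\le C^{(2)}_{R,\alpha}\,\delta^{\alpha-\sigma}.$$ For $S\subseteq\mathbb R^N$ put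 $I_x[S](\phi,x,p)=\int_{S}\big[\phi(x+z)-\phi(x)-\mathbf 1_{B_1}(z)\langle p,z\rangle\big]\nu_x(dz)$ if $\sigma\ge1$, and $I_x[S](\phi,x,p)=\int_{S}[\phi(x+z)-\phi(x)]\,\nu_x(dz)$ if $\sigma<1$; let $I_x=I_x[\mathbb R^N]$ and let $d_\Omega(x)$ be the distance from $x$ to $\partial\Omega$. A bounded Borel function $u:\mathbb R^N\to\mathbb R$ is a viscosity subsolution of $$-I_x(u,x)+b_0|Du(x)|^m=A\big(d_\Omega(x)^{-\theta}+1\big),\qquad x\in\Omega, \tag{P'}$$ if it is upper semicontinuous in $\Omega$ and, for all $x\in\Omega$, $\delta>0$ and $\phi\in C^2(\mathbb R^N)$ such that $u-\phi$ has a maximum over $B_\delta(x)$ at $x$, $$-I_x[B_\delta](\phi,x,D\phi(x))-I_x[B_\delta^c](u,x,D\phi(x))+b_0|D\phi(x)|^m\le A\big(d_\Omega(x)^{-\theta}+1\big).$$ Let $\tilde\gamma_0=(m-\sigma)/(m-1)$ if $\sigma>1$, let $\tilde\gamma_0$ be any number in $(0,1)$ if $\sigma=1$, let $\tilde\gamma_0=1$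 if $\sigma<1$, and put $\gamma_0=\min\{\tilde\gamma_0,(m-\theta)/m\}$. Let $\Omega_\nu=\Omega\cup\bigcup_{x\in\overline\Omega}(x+\operatorname{supp}\nu_x)$ and $\operatorname{osc}_{\Omega_\nu}u=\sup_{\Omega_\nu}u-\inf_{\Omega_\nu}u$. Then every bounded viscosity subsolution $u$ of (P') is locally Hölder continuous in $\Omega$ with exponent $\gamma_0$: for every compact $K\subset\Omega$ and every $L$ there is a constant $C$, depending only on $K$, $\Omega$, $L$ and the data ($N,A,b_0,\sigma,m,\theta,\tilde\gamma_0$ and the constants $C^{(1)}_{R,\alpha}$, $C^{(2)}_{R,\alpha}$), such that, if $\operatorname{osc}_{\Omega_\nu}u\le L$, $$|u(x)-u(y)|\le C|x-y|^{\gamma_0}\qquad\text{for all }x,y\in K .$$ -/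

import Mathlib

open MeasureTheory Set
open scoped NNReal ENNReal

noncomputable section

namespace NonlocalHJ

/-- The Euclidean space `ℝ^N`. -/
abbrev E (N : ℕ) : Type := EuclideanSpace ℝ (Fin N)

variable {N : ℕ}

/-- The rate function `h_{α,σ}(δ)`. -/
def rate (α σ δ : ℝ) : ℝ :=
  if α < σ then δ ^ (α - σ) else if α = σ then |Real.log δ| + 1 else 1

/-- Condition (M1) of order `σ` for the family of measures `ν`, with constants `c R α`:
`sup_{|x| ≤ R} ∫_{|z| ≥ δ} min {1, |z|^α} ν_x(dz) ≤ c R α * h_{α,σ}(δ)`. -/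
def M1 (σ : ℝ) (c : ℝ → ℝ → ℝ) (ν : E N → Measure (E N)) : Prop :=
  ∀ R > 0, ∀ α ∈ Icc (0 : ℝ) 2, 0 < c R α ∧
    ∀ δ > 0, ∀ x ∈ Metric.closedBall (0 : E N) R,
      ∫⁻ z in (Metric.ball (0 : E N) δ)ᶜ, ENNReal.ofReal (min 1 (‖z‖ ^ α)) ∂(ν x)
        ≤ ENNReal.ofReal (c R α * rate α σ δ)

/-- Condition (M2) of order `σ` for the family of measures `ν`, with constants `c R α`:
`sup_{|x| ≤ R} ∫_{|z| < δ} |z|^α ν_x(dz) ≤ c R α * δ^(α - σ)`. -/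
def M2 (σ : ℝ) (c : ℝ → ℝ → ℝ) (ν : E N → Measure (E N)) : Prop :=
  ∀ R > 0, ∀ α ∈ Ioc σ 2, 0 < c R α ∧
    ∀ δ ∈ Ioo (0 : ℝ) 1, ∀ x ∈ Metric.closedBall (0 : E N) R,
      ∫⁻ z in Metric.ball (0 : E N) δ, ENNReal.ofReal (‖z‖ ^ α) ∂(ν x)
        ≤ ENNReal.ofReal (c R α * δ ^ (α - σ))

/-- The integrand of the nonlocal operator: `φ(x+z) - φ(x) - 1_B(z) ⟨p, z⟩` if `σ ≥ 1`,
and `φ(x+z) - φ(x)` if `σ < 1`. -/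
def increment (σ : ℝ) (φ : E N → ℝ) (x p z : E N) : ℝ :=
  φ (x + z) - φ x -
    if 1 ≤ σ then (Metric.ball (0 : E N) 1).indicator (fun z => inner ℝ p z) z else 0

/-- The nonlocal operator restricted to jumps in `S`, with jump measure `μ`:
`I[S](φ, x, p) = ∫_S (φ(x+z) - φ(x) - 1_B(z) ⟨p, z⟩) μ(dz)`, uncompensated if `σ < 1`. -/
def nonlocal (σ : ℝ) (μ : Measure (E N)) (S : Set (E N)) (φ : E N → ℝ) (x p : E N) : ℝ :=
  ∫ z in S, increment σ φ x p z ∂μ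

/-- `u : ℝ^N → ℝ` is a viscosity subsolution of
`-I_x(u, x) + b₀ |Du(x)|^m = A (d_Ω(x)^(-θ) + 1)` in `Ω`: it is upper semicontinuous in `Ω` and,
whenever `φ` is `C²` and `u - φ` has a maximum over `B_δ(x)` at `x ∈ Ω`, the viscosity inequality
holds with `φ` used for the small jumps and `u` used for the large ones. -/
structure IsViscositySubsolution (σ : ℝ) (ν : E N → Measure (E N)) (b₀ m A θ : ℝ)
    (Ω : Set (E N)) (u : E N → ℝ) : Prop where
  usc : UpperSemicontinuousOn u Ω
  ineq : ∀ x ∈ Ω, ∀ δ > 0, ∀ φ : E N → ℝ, ContDiff ℝ 2 φ →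
    (∀ y ∈ Metric.ball x δ, u y - φ y ≤ u x - φ x) →
    - nonlocal σ (ν x) (Metric.ball 0 δ) φ x (gradient φ x)
      - nonlocal σ (ν x) (Metric.ball 0 δ)ᶜ u x (gradient φ x)
      + b₀ * ‖gradient φ x‖ ^ m
      ≤ A * (Metric.infDist x (frontier Ω) ^ (-θ) + 1)

/-- `Ω_ν = Ω ∪ ⋃_{x ∈ closure Ω} (x + supp ν_x)`. -/
def reachable (ν : E N → Measure (E N)) (Ω : Set (E N)) : Set (E N) :=
  Ω ∪ ⋃ x ∈ closure Ω, (fun z => x + z) '' (ν x).support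

/-- The oscillation `sup_S u - inf_S u`. -/
def osc (S : Set (E N)) (u : E N → ℝ) : ℝ := sSup (u '' S) - sInf (u '' S)

/-- The admissible values of the exponent `γ̃₀(σ, m)`: it is `(m - σ)/(m - 1)` if `σ > 1`,
an arbitrary number in `(0,1)` if `σ = 1`, and `1` if `σ < 1`. -/
def IsInteriorExponent (σ m γ : ℝ) : Prop :=
  (1 < σ → γ = (m - σ) / (m - 1)) ∧ (σ = 1 → γ ∈ Ioo (0 : ℝ) 1) ∧ (σ < 1 → γ = 1)

end NonlocalHJ

end

noncomputable section

namespace NonlocalHJ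

variable {N : ℕ}

/-! The gradient term, of power `m > 1`, beats the nonlocal diffusion. Fix `x` well inside `Ω` and
suppose `u - u x` exceeds the cusp `C‖· - x‖^γ` somewhere near `x`. Then `u - C‖· - x‖^γ` has a
maximum at some `w ≠ x`, and the oscillation bound keeps `r = ‖w - x‖` small. The cusp is not smooth
at `x`, but by concavity (`norm_add_rpow_le`) a globally smooth quadratic touches it from above at
`w`; this is the test function, with cut-off radius `r`.

Its gradient has norm `Cγ r^(γ-1)`, so the Hamiltonian is `b₀(Cγ)^m T` with `T = r^(m(γ-1)) ≥ 1`.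
Small jumps (`nonlocal_ball_quad_le`) and large jumps (`nonlocal_compl_ball_le`) contribute at most
a constant times `C T`, precisely because `m(γ-1) ≤ γ-σ`; the source is bounded away from the
boundary. As `m > 1`, a large `C` (`exists_slope`) gives a contradiction. Exchanging the two points
yields the Hölder bound. -/

/-- An upper bound for a Bochner integral from a dominating function; if the integrand is not
integrable, the integral vanishes and the bound is trivial. -/
theorem integral_le_of_lintegral_le {α : Type*} [MeasurableSpace α] {μ : Measure α}
    {f g : α → ℝ} {B : ℝ} (hfg : ∀ᵐ z ∂μ, f z ≤ g z) (hB : 0 ≤ B)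
    (hg : ∫⁻ z, ENNReal.ofReal (g z) ∂μ ≤ ENNReal.ofReal B) : ∫ z, f z ∂μ ≤ B := by
  by_cases hf : Integrable f μ
  · rw [integral_eq_lintegral_pos_part_sub_lintegral_neg_part hf]
    have h1 : ∫⁻ z, ENNReal.ofReal (f z) ∂μ ≤ ENNReal.ofReal B :=
      (lintegral_mono_ae (hfg.mono fun z hz => ENNReal.ofReal_le_ofReal hz)).trans hg
    have h2 : (∫⁻ z, ENNReal.ofReal (f z) ∂μ).toReal ≤ B := ENNReal.toReal_le_of_le_ofReal hB h1
    have h3 : 0 ≤ (∫⁻ z, ENNReal.ofReal (-f z) ∂μ).toReal := ENNReal.toReal_nonneg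
    linarith
  · rwa [integral_undef hf]

/-- The same bound for a dominating combination of two functions with nonnegative coefficients. -/
theorem integral_le_of_le_add_mul {α : Type*} [MeasurableSpace α] {μ : Measure α}
    {f g₁ g₂ : α → ℝ} {a₁ a₂ B₁ B₂ : ℝ} (ha₁ : 0 ≤ a₁) (ha₂ : 0 ≤ a₂) (hB₁ : 0 ≤ B₁)
    (hB₂ : 0 ≤ B₂) (hm₁ : Measurable g₁) (hm₂ : Measurable g₂)
    (hfg : ∀ᵐ z ∂μ, f z ≤ a₁ * g₁ z + a₂ * g₂ z)
    (h₁ : ∫⁻ z, ENNReal.ofReal (g₁ z) ∂μ ≤ ENNReal.ofReal B₁)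
    (h₂ : ∫⁻ z, ENNReal.ofReal (g₂ z) ∂μ ≤ ENNReal.ofReal B₂) :
    ∫ z, f z ∂μ ≤ a₁ * B₁ + a₂ * B₂ := by
  refine integral_le_of_lintegral_le hfg (by positivity) ?_
  calc ∫⁻ z, ENNReal.ofReal (a₁ * g₁ z + a₂ * g₂ z) ∂μ
      ≤ ∫⁻ z, (ENNReal.ofReal a₁ * ENNReal.ofReal (g₁ z)
          + ENNReal.ofReal a₂ * ENNReal.ofReal (g₂ z)) ∂μ := by
        refine lintegral_mono fun z => ?_
        rw [← ENNReal.ofReal_mul ha₁, ← ENNReal.ofReal_mul ha₂]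
        exact ENNReal.ofReal_add_le
    _ = ENNReal.ofReal a₁ * ∫⁻ z, ENNReal.ofReal (g₁ z) ∂μ
          + ENNReal.ofReal a₂ * ∫⁻ z, ENNReal.ofReal (g₂ z) ∂μ := by
        rw [lintegral_add_left (by fun_prop), lintegral_const_mul _ (by fun_prop),
          lintegral_const_mul _ (by fun_prop)]
    _ ≤ ENNReal.ofReal a₁ * ENNReal.ofReal B₁ + ENNReal.ofReal a₂ * ENNReal.ofReal B₂ := by
        gcongr
    _ = ENNReal.ofReal (a₁ * B₁ + a₂ * B₂) := by
        rw [← ENNReal.ofReal_mul ha₁, ← ENNReal.ofReal_mul ha₂,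
          ← ENNReal.ofReal_add (by positivity) (by positivity)]

/-! ### Inequalities for powers of the norm -/

/-- The function `‖·‖^γ`, `γ ≤ 2`, is touched from above at `a ≠ 0` by a quadratic polynomial,
because `t ↦ t^(γ/2)` is concave. -/
theorem norm_add_rpow_le {V : Type*} [NormedAddCommGroup V] [InnerProductSpace ℝ V] {γ : ℝ}
    (h0 : 0 ≤ γ) (h2 : γ ≤ 2) {a : V} (ha : a ≠ 0) (z : V) :
    ‖a + z‖ ^ γ ≤ ‖a‖ ^ γ + γ * ‖a‖ ^ (γ - 2) * inner ℝ a z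
      + γ / 2 * ‖a‖ ^ (γ - 2) * ‖z‖ ^ 2 := by
  have hr : 0 < ‖a‖ := norm_pos_iff.2 ha
  have hsq : ‖a + z‖ ^ 2 = ‖a‖ ^ 2 + 2 * inner ℝ a z + ‖z‖ ^ 2 := norm_add_sq_real a z
  set s : ℝ := (2 * inner ℝ a z + ‖z‖ ^ 2) / ‖a‖ ^ 2 with hs
  have hs1 : ‖a + z‖ ^ 2 = ‖a‖ ^ 2 * (1 + s) := by rw [hsq, hs]; field_simp; ring
  have hs2 : 0 ≤ 1 + s := by
    by_contra h
    have : ‖a‖ ^ 2 * (1 + s) < 0 := mul_neg_of_pos_of_neg (by positivity) (not_le.1 h)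
    linarith [sq_nonneg ‖a + z‖]
  have hpow : ∀ t : ℝ, 0 ≤ t → (t ^ 2) ^ (γ / 2) = t ^ γ := fun t ht => by
    rw [← Real.rpow_natCast, ← Real.rpow_mul ht]; congr 1; push_cast; ring
  have hb := rpow_one_add_le_one_add_mul_self (s := s) (by linarith) (p := γ / 2)
    (by linarith) (by linarith)
  calc ‖a + z‖ ^ γ = ‖a‖ ^ γ * (1 + s) ^ (γ / 2) := by
        rw [← hpow _ (norm_nonneg (a + z)), hs1, Real.mul_rpow (by positivity) hs2,
          hpow _ hr.le]
    _ ≤ ‖a‖ ^ γ * (1 + γ / 2 * s) := by gcongr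
    _ = _ := by
        rw [hs, Real.rpow_sub hr, Real.rpow_two]; field_simp; ring

theorem norm_add_rpow_le_add {V : Type*} [NormedAddCommGroup V] {γ : ℝ}
    (h0 : 0 < γ) (h1 : γ ≤ 1) (a z : V) : ‖a + z‖ ^ γ ≤ ‖a‖ ^ γ + ‖z‖ ^ γ :=
  (Real.rpow_le_rpow (norm_nonneg _) (norm_add_le a z) h0.le).trans
    (Real.rpow_add_le_add_rpow (norm_nonneg a) (norm_nonneg z) h0.le h1)

theorem rate_nonneg {α σ δ : ℝ} (hδ : 0 ≤ δ) : 0 ≤ rate α σ δ := by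
  unfold rate; split_ifs <;> positivity

/-! ### Quadratic test functions -/

/-- The quadratic polynomial `w ↦ ⟨p, w - y⟩ + κ |w - y|²`. -/
def quad (p y : E N) (κ : ℝ) (w : E N) : ℝ := inner ℝ p (w - y) + κ * ‖w - y‖ ^ 2

theorem quad_add (p y : E N) (κ : ℝ) (z : E N) :
    quad p y κ (y + z) = inner ℝ p z + κ * ‖z‖ ^ 2 := by simp [quad]

theorem quad_self (p y : E N) (κ : ℝ) : quad p y κ y = 0 := by simp [quad]

theorem contDiff_quad (p y : E N) (κ : ℝ) : ContDiff ℝ 2 (quad p y κ) := by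
  unfold quad
  exact (contDiff_const.inner ℝ (contDiff_id.sub contDiff_const)).add
    (contDiff_const.mul ((contDiff_id.sub contDiff_const).norm_sq ℝ))

theorem gradient_quad (p y : E N) (κ : ℝ) : gradient (quad p y κ) y = p := by
  apply HasGradientAt.gradient
  rw [hasGradientAt_iff_hasFDerivAt]
  have h1 : HasFDerivAt (fun w : E N => w - y) (ContinuousLinearMap.id ℝ (E N)) y :=
    (hasFDerivAt_id y).sub_const y
  have h2 := ((innerSL ℝ p).hasFDerivAt.comp y h1).add ((h1.norm_sq).const_mul κ)
  refine (h2.congr_fderiv ?_)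
  ext v
  simp

/-! ### Estimates of the nonlocal operator -/

/-- The small jumps act on the quadratic test function like a fractional operator of order `σ`. -/
theorem nonlocal_ball_quad_le {σ : ℝ} (hσ : σ ∈ Ioo (0 : ℝ) 2) {c : ℝ → ℝ → ℝ}
    {ν : E N → Measure (E N)} (hν : M2 σ c ν) {R : ℝ} (hR : 0 < R) {y : E N}
    (hy : y ∈ Metric.closedBall (0 : E N) R) {r : ℝ} (hr : r ∈ Ioo (0 : ℝ) 1) {C γ : ℝ}
    (hC : 0 ≤ C) (hγ : 0 ≤ γ) {p : E N} (hp : ‖p‖ = C * γ * r ^ (γ - 1)) :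
    nonlocal σ (ν y) (Metric.ball 0 r) (quad p y (C * γ / 2 * r ^ (γ - 2))) y p
      ≤ C * (2 * γ * c R (if 1 ≤ σ then 2 else 1)) * r ^ (γ - σ) := by
  have hr0 := hr.1
  set κ := C * γ / 2 * r ^ (γ - 2) with hκ
  have hκ0 : 0 ≤ κ := by positivity
  unfold nonlocal
  split_ifs with h
  · obtain ⟨hc, hint⟩ := hν R hR 2 ⟨hσ.2, le_rfl⟩
    have := integral_le_of_le_add_mul (μ := (ν y).restrict (Metric.ball 0 r))
      (f := increment σ (quad p y κ) y p) (g₁ := fun z => ‖z‖ ^ (2 : ℝ)) (g₂ := fun _ => 0)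
      (a₁ := κ) (a₂ := 0) (B₂ := 0) (B₁ := c R 2 * r ^ (2 - σ)) hκ0 le_rfl (by positivity) le_rfl
      (by fun_prop) (by fun_prop) ?_ (hint r hr y hy) (by simp)
    · refine this.trans ?_
      have e : r ^ (γ - 2) * r ^ (2 - σ) = r ^ (γ - σ) := by
        rw [← Real.rpow_add hr0]; congr 1; ring
      have : 0 ≤ C * γ * c R 2 * r ^ (γ - σ) := by positivity
      calc κ * (c R 2 * r ^ (2 - σ)) + 0 * 0
          = C * γ / 2 * c R 2 * (r ^ (γ - 2) * r ^ (2 - σ)) := by rw [hκ]; ring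
        _ ≤ _ := by rw [e]; nlinarith
    · refine (ae_restrict_iff' measurableSet_ball).2 (ae_of_all _ fun z hz => ?_)
      -- As `r < 1`, the compensator cancels the whole linear part.
      have hz1 : z ∈ Metric.ball (0 : E N) 1 := Metric.ball_subset_ball hr.2.le hz
      simp only [increment, if_pos h, indicator_of_mem hz1, quad_add, quad_self, Real.rpow_two]
      linarith
  -- The linear part is not compensated here, but first moments of small jumps are finite because `σ
  -- < 1`.
  · obtain ⟨hc, hint⟩ := hν R hR 1 ⟨not_le.1 h, by norm_num⟩
    have := integral_le_of_le_add_mul (μ := (ν y).restrict (Metric.ball 0 r))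
      (f := increment σ (quad p y κ) y p) (g₁ := fun z => ‖z‖ ^ (1 : ℝ)) (g₂ := fun _ => 0)
      (a₁ := ‖p‖ + κ * r) (a₂ := 0) (B₂ := 0) (B₁ := c R 1 * r ^ (1 - σ)) (by positivity) le_rfl
      (by positivity) le_rfl
      (by fun_prop) (by fun_prop) ?_ (hint r hr y hy) (by simp)
    · refine this.trans ?_
      have e : r ^ (γ - 1) * r ^ (1 - σ) = r ^ (γ - σ) := by
        rw [← Real.rpow_add hr0]; congr 1; ring
      have e' : r ^ (γ - 2) * r = r ^ (γ - 1) := by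
        rw [← Real.rpow_add_one hr0.ne']; congr 1; ring
      have : 0 ≤ C * γ * c R 1 * r ^ (γ - σ) := by positivity
      calc (‖p‖ + κ * r) * (c R 1 * r ^ (1 - σ)) + 0 * 0
          = (C * γ * r ^ (γ - 1) + C * γ / 2 * (r ^ (γ - 2) * r)) * (c R 1 * r ^ (1 - σ)) := by
            rw [hκ, hp]; ring
        _ = C * γ * (3 / 2) * c R 1 * (r ^ (γ - 1) * r ^ (1 - σ)) := by rw [e']; ring
        _ ≤ _ := by rw [e]; nlinarith
    · refine (ae_restrict_iff' measurableSet_ball).2 (ae_of_all _ fun z hz => ?_)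
      have hz1 : ‖z‖ < r := by simpa using hz
      simp only [increment, if_neg h, quad_add, quad_self, Real.rpow_one]
      have h1 := real_inner_le_norm p z
      have h2 : κ * ‖z‖ ^ 2 ≤ κ * (r * ‖z‖) := by
        rw [sq]; gcongr
      linarith

/-- The large jumps of a function whose increments grow at most like `min {1, |z|^γ}`. -/
theorem nonlocal_compl_ball_le {σ : ℝ} {c : ℝ → ℝ → ℝ}
    {ν : E N → Measure (E N)} (hν : M1 σ c ν) {R : ℝ} (hR : 0 < R) {y : E N}
    (hy : y ∈ Metric.closedBall (0 : E N) R) {r : ℝ} (hr : 0 < r) {C γ : ℝ}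
    (hC : 0 ≤ C) (hγ : γ ∈ Icc (0 : ℝ) 2) {u : E N → ℝ}
    (hu : ∀ᵐ z ∂ν y, u (y + z) - u y ≤ C * min 1 (‖z‖ ^ γ)) (p : E N) :
    nonlocal σ (ν y) (Metric.ball 0 r)ᶜ u y p
      ≤ C * (c R γ * rate γ σ r) + ‖p‖ * (c R 1 * rate 1 σ r) := by
  obtain ⟨hc, hint⟩ := hν R hR γ hγ
  obtain ⟨hc1, hint1⟩ := hν R hR 1 (by norm_num)
  have h0 := rate_nonneg (α := γ) (σ := σ) hr.le
  have h1 := rate_nonneg (α := 1) (σ := σ) hr.le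
  refine integral_le_of_le_add_mul hC (norm_nonneg p) (by positivity) (by positivity)
    (by fun_prop) (by fun_prop) ?_ (hint r hr y hy) (hint1 r hr y hy)
  filter_upwards [ae_restrict_of_ae hu] with z hz
  have hz0 : 0 ≤ ‖p‖ * min 1 (‖z‖ ^ (1 : ℝ)) := by positivity
  unfold increment
  by_cases hs : 1 ≤ σ
  · rw [if_pos hs]
    by_cases hz1 : z ∈ Metric.ball (0 : E N) 1
    · rw [indicator_of_mem hz1]
      have hz2 : ‖z‖ < 1 := by simpa using hz1
      have h3 : min 1 (‖z‖ ^ (1 : ℝ)) = ‖z‖ := by rw [Real.rpow_one]; exact min_eq_right hz2.le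
      have := (abs_le.1 (abs_real_inner_le_norm p z)).1
      rw [h3]; linarith
    · rw [indicator_of_notMem hz1]; linarith
  · rw [if_neg hs]; linarith

/-! ### Arithmetic of the exponent -/

theorem interiorExponent_mem {σ m γ : ℝ} (hm : max 1 σ < m)
    (hγ : IsInteriorExponent σ m γ) : γ ∈ Ioc (0 : ℝ) 1 := by
  obtain ⟨hm1, hmσ⟩ := max_lt_iff.1 hm
  rcases lt_trichotomy σ 1 with h | h | h
  · rw [hγ.2.2 h]; norm_num
  · exact Ioo_subset_Ioc_self (hγ.2.1 h)
  · rw [hγ.1 h]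
    exact ⟨div_pos (by linarith) (by linarith), (div_le_one (by linarith)).2 (by linarith)⟩

/-- The exponent is chosen so that the Hamiltonian dominates the operator of order `σ`. -/
theorem mul_sub_one_le_sub {σ m γ : ℝ} (hm : max 1 σ < m)
    (hγ : IsInteriorExponent σ m γ) : m * (γ - 1) ≤ γ - σ := by
  obtain ⟨hm1, hmσ⟩ := max_lt_iff.1 hm
  rcases lt_trichotomy σ 1 with h | h | h
  · rw [hγ.2.2 h]; linarith
  · have := hγ.2.1 h
    nlinarith [this.2]
  · have : (m - 1) * γ = m - σ := by
      rw [hγ.1 h]; field_simp [show m - 1 ≠ 0 by linarith]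
    linarith

/-- The logarithmic case never occurs: `γ < σ` if `1 ≤ σ`, and `γ = 1 > σ` otherwise. -/
theorem rate_self_le {σ m γ : ℝ} (hm : max 1 σ < m) (hγ : IsInteriorExponent σ m γ) {r : ℝ}
    (hr : r ∈ Ioo (0 : ℝ) 1) : rate γ σ r ≤ r ^ (m * (γ - 1)) := by
  rcases lt_or_ge σ 1 with h | h
  · simp [rate, hγ.2.2 h, h.ne', h.not_gt]
  · have h1 : γ < σ := by
      rcases h.eq_or_lt with h | h
      · linarith [(hγ.2.1 h.symm).2]
      · linarith [(interiorExponent_mem hm hγ).2]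
    rw [rate, if_pos h1]
    exact Real.rpow_le_rpow_of_exponent_ge hr.1 hr.2.le (mul_sub_one_le_sub hm hγ)

/-- Controls the compensator of the large jumps. At `σ = 1` the logarithm is absorbed by the spare
power `r^((m-1)(1-γ))`, which needs `γ < 1`. -/
theorem exists_rpow_mul_rate_one_le {σ m γ : ℝ} (hm : max 1 σ < m)
    (hγ : IsInteriorExponent σ m γ) :
    ∃ M : ℝ, ∀ r ∈ Ioo (0 : ℝ) 1, r ^ (γ - 1) * rate 1 σ r ≤ M * r ^ (m * (γ - 1)) := by
  obtain ⟨hm1, hmσ⟩ := max_lt_iff.1 hm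
  rcases lt_trichotomy σ 1 with h | h | h
  · refine ⟨1, fun r hr => ?_⟩
    simp [rate, hγ.2.2 h, h.ne', h.not_gt]
  · have hγ1 := hγ.2.1 h
    set ε := (m - 1) * (1 - γ) with hε
    have hε0 : 0 < ε := mul_pos (by linarith) (by linarith [hγ1.2])
    refine ⟨1 / ε + 1, fun r hr => ?_⟩
    have hr0 := hr.1
    have h1 : |Real.log r| * r ^ ε ≤ 1 / ε := by
      have := Real.abs_log_mul_self_rpow_lt r ε hr.1 hr.2.le hε0
      rw [abs_mul, abs_of_nonneg (Real.rpow_nonneg hr0.le ε)] at this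
      exact this.le
    have h2 : r ^ ε ≤ 1 := Real.rpow_le_one hr0.le hr.2.le hε0.le
    have e : r ^ (γ - 1) = r ^ ε * r ^ (m * (γ - 1)) := by
      rw [← Real.rpow_add hr0]; congr 1; rw [hε]; ring
    have e2 : rate 1 σ r = |Real.log r| + 1 := by simp [rate, h]
    rw [e, e2, mul_right_comm]
    gcongr
    linarith
  · refine ⟨1, fun r hr => ?_⟩
    rw [rate, if_pos h, ← Real.rpow_add hr.1, one_mul]
    refine Real.rpow_le_rpow_of_exponent_ge hr.1 hr.2.le ?_
    have := mul_sub_one_le_sub hm hγ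
    linarith

/-! ### Oscillation and distance to the boundary -/

theorem sub_le_osc {S : Set (E N)} {u : E N → ℝ} (hu : ∃ M : ℝ, ∀ x, |u x| ≤ M) {a b : E N}
    (ha : a ∈ S) (hb : b ∈ S) : u a - u b ≤ osc S u := by
  obtain ⟨M, hM⟩ := hu
  refine sub_le_sub (le_csSup ⟨M, ?_⟩ ⟨a, ha, rfl⟩) (csInf_le ⟨-M, ?_⟩ ⟨b, hb, rfl⟩)
  · rintro _ ⟨x, -, rfl⟩; exact (abs_le.1 (hM x)).2
  · rintro _ ⟨x, -, rfl⟩; exact (abs_le.1 (hM x)).1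

theorem infDist_frontier_rpow_neg_le {Ω : Set (E N)} (hΩ : IsOpen Ω) {y : E N} {ρ θ : ℝ}
    (hρ : 0 < ρ) (hρ1 : ρ ≤ 1) (hθ : 0 ≤ θ) (hy : Metric.ball y ρ ⊆ Ω) :
    Metric.infDist y (frontier Ω) ^ (-θ) ≤ ρ ^ (-θ) := by
  rcases (frontier Ω).eq_empty_or_nonempty with h | h
  -- With empty frontier the distance defaults to `0`, and `0 ^ (-θ)` is `1` or `0`; `ρ ≤ 1` covers
  -- both.
  · rw [h, Metric.infDist_empty]
    refine le_trans ?_ (Real.one_le_rpow_of_pos_of_le_one_of_nonpos hρ hρ1 (by linarith))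
    rcases hθ.eq_or_lt with h | h
    · simp [← h]
    · rw [Real.zero_rpow (by linarith)]; norm_num
  · refine Real.rpow_le_rpow_of_nonpos hρ ?_ (by linarith)
    refine (Metric.le_infDist h).2 fun w hw => ?_
    by_contra hlt
    have : w ∈ Ω := hy (by rw [Metric.mem_ball']; exact not_le.1 hlt)
    rw [hΩ.frontier_eq] at hw
    exact hw.2 this

/-! ### Comparison with the cusp -/

/-- If the slope `C` is large, a bounded subsolution lies below the cusp
`u x + C min {1, |y - x|^γ}`. -/
theorem IsViscositySubsolution.sub_le {Ω : Set (E N)} (hΩo : IsOpen Ω)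
    {A b₀ σ m θ γ L : ℝ} (hA : 0 < A) (hσ : σ ∈ Ioo (0 : ℝ) 2)
    (hm : max 1 σ < m) (hθ : 0 ≤ θ) (hγ : IsInteriorExponent σ m γ)
    {c₁ c₂ : ℝ → ℝ → ℝ} {ν : E N → Measure (E N)} (hν₁ : M1 σ c₁ ν) (hν₂ : M2 σ c₂ ν)
    {u : E N → ℝ} (hub : ∃ M : ℝ, ∀ x, |u x| ≤ M)
    (hu : IsViscositySubsolution σ ν b₀ m A θ Ω u) (hL : osc (reachable ν Ω) u ≤ L)
    {R M ρ C : ℝ} (hR : 0 < R) (hΩR : Ω ⊆ Metric.closedBall 0 R)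
    (hM : ∀ r ∈ Ioo (0 : ℝ) 1, r ^ (γ - 1) * rate 1 σ r ≤ M * r ^ (m * (γ - 1)))
    (hρ : 0 < ρ) (hρ1 : ρ ≤ 1) (hC : 0 < C) (hCL : L ≤ C * ρ ^ γ)
    (hCm : A * (ρ ^ (-θ) + 1)
      + C * (2 * γ * c₂ R (if 1 ≤ σ then 2 else 1) + c₁ R γ + γ * c₁ R 1 * M)
        < b₀ * (C * γ) ^ m)
    {x : E N} (hx : Metric.closedBall x (2 * ρ) ⊆ Ω) {y : E N} (hy : y ∈ Ω) :
    u y - u x ≤ C * min 1 (‖y - x‖ ^ γ) := by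
  obtain ⟨hm1, hmσ⟩ := max_lt_iff.1 hm
  have hγI := interiorExponent_mem hm hγ
  have hγ0 : 0 < γ := hγI.1
  have hxΩ : x ∈ Ω := hx (Metric.mem_closedBall_self (by positivity))
  have hosc : ∀ a ∈ reachable ν Ω, ∀ b ∈ reachable ν Ω, u a - u b ≤ L :=
    fun a ha b hb => (sub_le_osc hub ha hb).trans hL
  have hfar : ∀ t : ℝ, ρ ≤ t → L ≤ C * min 1 (t ^ γ) := fun t ht => by
    refine hCL.trans (mul_le_mul_of_nonneg_left (le_min ?_ ?_) hC.le)
    · exact Real.rpow_le_one hρ.le hρ1 hγ0.le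
    · exact Real.rpow_le_rpow hρ.le ht hγ0.le
  have hΩreach : Ω ⊆ reachable ν Ω := subset_union_left
  by_cases hyρ : ρ ≤ ‖y - x‖
  · exact (hosc y (hΩreach hy) x (hΩreach hxΩ)).trans (hfar _ hyρ)
  rw [not_le] at hyρ
  rw [min_eq_right (Real.rpow_le_one (norm_nonneg _) (hyρ.le.trans hρ1) hγ0.le)]
  by_contra! hlt
  -- The maximum point of `u - C |· - x|^γ`.
  have hcont : Continuous fun w : E N => -(C * ‖w - x‖ ^ γ) :=
    ((continuous_const.mul ((continuous_id.sub continuous_const).norm.rpow_const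
      fun _ => Or.inr hγ0.le))).neg
  have husc : UpperSemicontinuousOn (fun w => u w + -(C * ‖w - x‖ ^ γ))
      (Metric.closedBall x (2 * ρ)) :=
    (hu.usc.mono hx).add hcont.continuousOn.upperSemicontinuousOn
  obtain ⟨w, hw, hmax⟩ := husc.exists_isMaxOn ⟨x, Metric.mem_closedBall_self (by positivity)⟩
    (isCompact_closedBall x (2 * ρ))
  have hwΩ := hx hw
  have hwpos : C * ‖w - x‖ ^ γ < u w - u x := by
    have := hmax (show y ∈ Metric.closedBall x (2 * ρ) by
      rw [mem_closedBall_iff_norm]; linarith)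
    simp only [mem_ofPred_eq] at this
    linarith
  set r := ‖w - x‖ with hr
  have hrρ : r < ρ := by
    by_contra! h
    have h1 := hosc w (hΩreach hwΩ) x (hΩreach hxΩ)
    have h2 := hfar r h
    have h3 : C * min 1 (r ^ γ) ≤ C * r ^ γ := by gcongr; exact min_le_right _ _
    linarith
  have hwx : w - x ≠ 0 := by
    intro h
    rw [hr, h, norm_zero, Real.zero_rpow hγ0.ne', sub_eq_zero.1 h] at hwpos
    simp at hwpos
  have hr0 : 0 < r := norm_pos_iff.2 hwx
  have hrI : r ∈ Ioo (0 : ℝ) 1 := ⟨hr0, hrρ.trans_le hρ1⟩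
  -- Jumps shorter than `ρ` stay in the ball of radius `2ρ` where `w` is a maximum point.
  have hinc : ∀ z : E N, ‖z‖ < ρ → u (w + z) - u w ≤ C * ‖(w - x) + z‖ ^ γ - C * r ^ γ := by
    intro z hz
    have e : w + z - x = (w - x) + z := by abel
    have := hmax (show w + z ∈ Metric.closedBall x (2 * ρ) by
      rw [mem_closedBall_iff_norm, e]
      linarith [norm_add_le (w - x) z])
    simp only [mem_ofPred_eq, e] at this
    linarith
  -- The gradient of the cusp at `w`.
  set p : E N := (C * γ * r ^ (γ - 2)) • (w - x) with hp
  have hpn : ‖p‖ = C * γ * r ^ (γ - 1) := by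
    rw [hp, norm_smul, Real.norm_of_nonneg (by positivity), ← hr, mul_assoc,
      ← Real.rpow_add_one hr0.ne']
    congr 2; ring
  set κ := C * γ / 2 * r ^ (γ - 2) with hκ
  have htest : ∀ v ∈ Metric.ball w r, u v - quad p w κ v ≤ u w - quad p w κ w := by
    intro v hv
    have hz : ‖v - w‖ < r := by rwa [mem_ball_iff_norm] at hv
    have h1 := hinc (v - w) (hz.trans hrρ)
    have h2 := norm_add_rpow_le hγ0.le (by linarith [hγI.2]) hwx (v - w)
    have h3 := mul_le_mul_of_nonneg_left h2 hC.le
    have h4 : quad p w κ v = C * (γ * r ^ (γ - 2) * inner ℝ (w - x) (v - w)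
        + γ / 2 * r ^ (γ - 2) * ‖v - w‖ ^ 2) := by
      rw [quad, hp, inner_smul_left, hκ]; simp; ring
    rw [add_sub_cancel] at h1
    rw [quad_self, h4]
    linarith
  have hvisc := hu.ineq w hwΩ r hr0 _ (contDiff_quad p w κ) htest
  rw [gradient_quad] at hvisc
  have hwR := hΩR hwΩ
  have hsmall := nonlocal_ball_quad_le hσ hν₂ hR hwR hrI hC.le hγ0.le hpn
  rw [← hκ] at hsmall
  -- Long jumps land in `reachable ν Ω` and cost at most the oscillation; short ones follow the
  -- cusp, whose increments are at most `C‖z‖^γ` by subadditivity.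
  have hae : ∀ᵐ z ∂ν w, u (w + z) - u w ≤ C * min 1 (‖z‖ ^ γ) := by
    filter_upwards [(ν w).support_mem_ae] with z hz
    by_cases hzρ : ρ ≤ ‖z‖
    · refine (hosc _ (Or.inr ?_) w (hΩreach hwΩ)).trans (hfar _ hzρ)
      exact mem_iUnion₂.2 ⟨w, subset_closure hwΩ, z, hz, rfl⟩
    · rw [not_le] at hzρ
      rw [min_eq_right (Real.rpow_le_one (norm_nonneg _) (hzρ.le.trans hρ1) hγ0.le)]
      have h1 := hinc z hzρ
      have h2 := mul_le_mul_of_nonneg_left (norm_add_rpow_le_add hγ0 hγI.2 (w - x) z) hC.le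
      linarith
  have hlarge := nonlocal_compl_ball_le (σ := σ) hν₁ hR hwR hr0 hC.le
    ⟨hγ0.le, by linarith [hγI.2]⟩ hae p
  have hdist : Metric.infDist w (frontier Ω) ^ (-θ) ≤ ρ ^ (-θ) := by
    refine infDist_frontier_rpow_neg_le hΩo hρ hρ1 hθ fun v hv => hx ?_
    rw [mem_ball_iff_norm] at hv
    rw [mem_closedBall_iff_norm]
    have := norm_add_le (v - w) (w - x)
    rw [sub_add_sub_cancel] at this
    linarith
  -- The common scale: once every term is compared with `T`, the viscosity inequality contradicts
  -- `hCm` multiplied by `T`.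
  set T := r ^ (m * (γ - 1)) with hT
  have hT1 : 1 ≤ T := Real.one_le_rpow_of_pos_of_le_one_of_nonpos hr0 hrI.2.le
    (mul_nonpos_of_nonneg_of_nonpos (by linarith) (by linarith [hγI.2]))
  have hpm : ‖p‖ ^ m = (C * γ) ^ m * T := by
    rw [hpn, Real.mul_rpow (by positivity) (by positivity), ← Real.rpow_mul hr0.le, hT,
      mul_comm m]
  have hc₂ : 0 < c₂ R (if 1 ≤ σ then 2 else 1) := by
    split_ifs with h
    · exact (hν₂ R hR 2 ⟨hσ.2, le_rfl⟩).1
    · exact (hν₂ R hR 1 ⟨not_le.1 h, by norm_num⟩).1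
  have hc₁ : 0 < c₁ R γ := (hν₁ R hR γ ⟨hγ0.le, by linarith [hγI.2]⟩).1
  have hc₁' : 0 < c₁ R 1 := (hν₁ R hR 1 (by norm_num)).1
  have hsmall' : C * (2 * γ * c₂ R (if 1 ≤ σ then 2 else 1)) * r ^ (γ - σ)
      ≤ C * (2 * γ * c₂ R (if 1 ≤ σ then 2 else 1)) * T :=
    mul_le_mul_of_nonneg_left
      (Real.rpow_le_rpow_of_exponent_ge hr0 hrI.2.le (mul_sub_one_le_sub hm hγ)) (by positivity)
  have hlarge₁ : C * (c₁ R γ * rate γ σ r) ≤ C * (c₁ R γ * T) := by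
    gcongr; exact rate_self_le hm hγ hrI
  have hlarge₂ : ‖p‖ * (c₁ R 1 * rate 1 σ r) ≤ C * γ * c₁ R 1 * (M * T) := by
    calc ‖p‖ * (c₁ R 1 * rate 1 σ r) = C * γ * c₁ R 1 * (r ^ (γ - 1) * rate 1 σ r) := by
          rw [hpn]; ring
      _ ≤ _ := mul_le_mul_of_nonneg_left (hM r hrI) (by positivity)
  have hrhs : A * (Metric.infDist w (frontier Ω) ^ (-θ) + 1) ≤ A * (ρ ^ (-θ) + 1) * T := by
    calc _ ≤ A * (ρ ^ (-θ) + 1) := by gcongr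
      _ ≤ _ := le_mul_of_one_le_right (by positivity) hT1
  have hfin := mul_lt_mul_of_pos_right hCm (zero_lt_one.trans_le hT1)
  rw [hpm] at hvisc
  linarith

/-! ### Choice of the slope and conclusion -/

theorem exists_slope {b γ m : ℝ} (hb : 0 < b) (hγ : 0 < γ) (hm : 1 < m) (a M C₀ : ℝ) :
    ∃ C : ℝ, C₀ ≤ C ∧ 0 < C ∧ a + C * M < b * (C * γ) ^ m := by
  have h := (tendsto_rpow_atTop (sub_pos.2 hm)).const_mul_atTop
    (show 0 < b * γ ^ m by positivity)
  obtain ⟨C, h1, h2, h3⟩ := ((h.eventually_gt_atTop (|a| + M)).and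
    ((Filter.eventually_ge_atTop C₀).and (Filter.eventually_ge_atTop 1))).exists
  have hC : 0 < C := by linarith
  refine ⟨C, h2, hC, ?_⟩
  have e : b * (C * γ) ^ m = C * (b * γ ^ m * C ^ (m - 1)) := by
    rw [Real.mul_rpow hC.le hγ.le, Real.rpow_sub_one hC.ne']; field_simp
  rw [e]
  have := mul_lt_mul_of_pos_left h1 hC
  nlinarith [le_abs_self a, abs_nonneg a]

end NonlocalHJ

end

theorem mainTheorem4 (N : ℕ) (Ω : Set (NonlocalHJ.E N)) (hΩo : IsOpen Ω)
    (hΩb : Bornology.IsBounded Ω)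
    (A b₀ σ m θ γ : ℝ) (hA : 0 < A) (hb₀ : 0 < b₀) (hσ : σ ∈ Set.Ioo (0 : ℝ) 2)
    (hm : max 1 σ < m) (hθ : θ ∈ Set.Ico 0 m)
    (hγ : NonlocalHJ.IsInteriorExponent σ m γ)
    (c₁ c₂ : ℝ → ℝ → ℝ) :
    ∀ K : Set (NonlocalHJ.E N), IsCompact K → K ⊆ Ω → ∀ L : ℝ, ∃ C : NNReal,
      ∀ ν : NonlocalHJ.E N → MeasureTheory.Measure (NonlocalHJ.E N),
        NonlocalHJ.M1 σ c₁ ν → NonlocalHJ.M2 σ c₂ ν →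
        ∀ u : NonlocalHJ.E N → ℝ, Measurable u → (∃ M : ℝ, ∀ x, |u x| ≤ M) →
          NonlocalHJ.IsViscositySubsolution σ ν b₀ m A θ Ω u →
          NonlocalHJ.osc (NonlocalHJ.reachable ν Ω) u ≤ L →
          HolderOnWith C (Real.toNNReal (min γ ((m - θ) / m))) u K := by
  intro K hK hKΩ L
  obtain ⟨hm1, hmσ⟩ := max_lt_iff.1 hm
  have hγI := NonlocalHJ.interiorExponent_mem hm hγ
  obtain ⟨R, hR, hΩR⟩ := hΩb.subset_closedBall_lt 0 0
  obtain ⟨δ, hδ, hKδ⟩ := hK.exists_cthickening_subset_open hΩo hKΩ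
  obtain ⟨M, hM⟩ := NonlocalHJ.exists_rpow_mul_rate_one_le hm hγ
  -- Balls of radius `2ρ ≤ δ` centred in `K` stay in `Ω`.
  set ρ := min (δ / 2) 1 with hρ
  have hρ0 : 0 < ρ := by positivity
  have hργ : 0 < ρ ^ γ := by positivity
  obtain ⟨C, hCL, hC, hCm⟩ := NonlocalHJ.exists_slope hb₀ hγI.1 hm1 (A * (ρ ^ (-θ) + 1))
    (2 * γ * c₂ R (if 1 ≤ σ then 2 else 1) + c₁ R γ + γ * c₁ R 1 * M) (L / ρ ^ γ)
  refine ⟨C.toNNReal, fun ν hν₁ hν₂ u _ hub hu hL => ?_⟩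
  set β := min γ ((m - θ) / m) with hβ
  have hβ0 : 0 < β := lt_min hγI.1 (div_pos (by linarith [hθ.2]) (by linarith))
  have hone : ∀ x ∈ K, ∀ y ∈ K, u y - u x ≤ C * dist y x ^ β := by
    intro x hx y hy
    have hball : Metric.closedBall x (2 * ρ) ⊆ Ω := by
      refine (Metric.closedBall_subset_closedBall ?_).trans
        ((Metric.closedBall_subset_cthickening hx δ).trans hKδ)
      linarith [min_le_left (δ / 2) 1]
    refine (hu.sub_le hΩo hA hσ hm hθ.1 hγ hν₁ hν₂ hub hL hR hΩR hM hρ0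
      (min_le_right _ _) hC ((div_le_iff₀ hργ).1 hCL) hCm hball (hKΩ hy)).trans ?_
    rw [dist_eq_norm]
    refine mul_le_mul_of_nonneg_left ?_ hC.le
    -- The truncation at `1` lets the exponent drop from `γ` to `β` without changing `C`.
    rcases le_total ‖y - x‖ 1 with h | h
    · exact (min_le_right _ _).trans
        (Real.rpow_le_rpow_of_exponent_ge' (norm_nonneg _) h hβ0.le (min_le_left _ _))
    · exact (min_le_left _ _).trans (Real.one_le_rpow h hβ0.le)
  intro x hx y hy
  have habs : dist (u x) (u y) ≤ C * dist x y ^ β := by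
    rw [Real.dist_eq, abs_le]
    have h1 := hone x hx y hy
    have h2 := hone y hy x hx
    rw [dist_comm] at h1
    constructor <;> linarith
  rw [edist_dist, edist_dist, Real.coe_toNNReal _ hβ0.le,
    ENNReal.ofReal_rpow_of_nonneg dist_nonneg hβ0.le]
  change _ ≤ ENNReal.ofReal C * _
  rw [← ENNReal.ofReal_mul hC.le]
  exact ENNReal.ofReal_le_ofReal habs
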